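/- Let $1\le i\le n$, let $X\subseteq\mathbb R^n$, and consider a non-autonomous system $\dot x=f(x,t)$, $t\ge 0$, where $f(\cdot,t)$ is differentiable at every point of $X$, with Jacobian $J(x,t)=\partial f/\partial x$. For a function $g(x,t)$ write $\dot g=\partial g/\partial t+(\partial g/\partial x)f(x,t)$ for its total time derivative along the system. Let $\Theta(x,t)\in\mathbb C^{n\times n}$ be a metric transformation on $X\times[0,\infty)$, i.e. $\Theta$ is differentiable and there is $\beta>0$ with $\Theta(x,t)^{*}\Theta(x,t)\succeq\beta I$ for all $x\in X$, $t\ge0$. Let $F=\Theta J\Theta^{-1}+\dot\Theta\,\Theta^{-1}$ be the generalized Jacobian and let $\lambda_1(x,t)\ge\dots\ge\lambda_n(x,t)$ be the eigenvalues of its Hermitian part $\tfrac12(F+F^{*})$. Let $\gamma(x,t)$ be a real-valued function that is differentiable and bounded on $X\times[0,\infty)$ (for instance a function $\gamma(t)$ of time alone). Suppose that for some $\alpha>0$ $$\lambda_1(x,t)+\dots+\lambda_i(x,t)+\dot\gamma(x,t)\le-\alpha\qquad\text{for all }x\in X,\ t\ge0 .$$ Then every $i$-dimensional differential volume shrinks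 exponentially to zero with rate $\alpha$: there is a constant $C>0$ such that for every $t_0\ge0$, every solution $x(t)$ of the system on $[t_0,\infty)$ that stays in $X$, and all differential displacements $\delta x_1,\dots,\delta x_i$ along it (solutions of $\tfrac{d}{dt}\delta x_j=J(x(t),t)\,\delta x_j$ on $[t_0,\infty)$), the vectors $\delta z_j(t)=\Theta(x(t),t)\,\delta x_j(t)$ satisfy $$\|\delta z_1(t)\wedge\dots\wedge\delta z_i(t)\|\le C\,e^{-\alpha(t-t_0)}\,\|\delta z_1(t_0)\wedge\dots\wedge\delta z_i(t_0)\|\qquad\text{for all }t\ge t_0,$$ and in particular $\|\delta z_1(t)\wedge\dots\wedge\delta z_i(t)\|\to0$ as $t\to\infty$. Here $\|v_1\wedge\dots\wedge v_i\|=\sqrt{\det(\langle v_j,v_k\rangle)_{j,k}}$ is the $i$-dimensional volume of the parallelotope spanned by $v_1,\dots,v_i$. -/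

import Mathlib

open Set Filter Topology

noncomputable section

open scoped ComplexOrder

namespace VolumeContraction

/-- The state space `ℝⁿ` with the Euclidean norm. -/
abbrev State (n : ℕ) : Type := EuclideanSpace ℝ (Fin n)

/-- Space-time `ℝⁿ × [0, ∞)`. Derivatives of functions of `(x, t)` are taken within this set, so that
they are one-sided in time at `t = 0` and ordinary derivatives for `t > 0`. -/
def spaceTime (n : ℕ) : Set (State n × ℝ) := univ ×ˢ Ici 0

/-- Differentiability in `(x, t)` jointly (one-sided in time at `t = 0`), at all points of
`X × [0, ∞)`. -/
def DifferentiableOnTube {n : ℕ} {G : Type*} [NormedAddCommGroup G] [NormedSpace ℝ G]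
    (X : Set (State n)) (g : State n → ℝ → G) : Prop :=
  ∀ x ∈ X, ∀ t : ℝ, 0 ≤ t →
    DifferentiableWithinAt ℝ (fun p : State n × ℝ => g p.1 p.2) (spaceTime n) (x, t)

/-- The total time derivative `ġ = ∂g/∂t + (∂g/∂x) f(x, t)` of `g(x, t)` along the system
`ẋ = f(x, t)`. -/
def totalDeriv {n : ℕ} {G : Type*} [NormedAddCommGroup G] [NormedSpace ℝ G]
    (f : State n → ℝ → State n) (g : State n → ℝ → G) (x : State n) (t : ℝ) : G :=
  fderivWithin ℝ (fun p : State n × ℝ => g p.1 p.2) (spaceTime n) (x, t) (f x t, 1)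

/-- The Jacobian matrix `J = ∂f/∂x`, with real entries regarded as complex numbers. -/
def jacobian {n : ℕ} (f : State n → ℝ → State n) (x : State n) (t : ℝ) :
    Matrix (Fin n) (Fin n) ℂ :=
  Matrix.of fun a b => ((fderiv ℝ (fun y => f y t) x (EuclideanSpace.single b 1) a : ℝ) : ℂ)

/-- A (possibly complex) metric transformation on `X × [0, ∞)`: a differentiable matrix function
`Θ(x, t)` for which the metric `Θᴴ Θ` is uniformly positive definite. Real transformations are
those with real entries. -/
structure IsMetricTransformation {n : ℕ} (X : Set (State n))
    (Θ : State n → ℝ → Matrix (Fin n) (Fin n) ℂ) : Prop where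
  differentiable : ∀ a b, DifferentiableOnTube X fun x t => Θ x t a b
  uniformly_posDef : ∃ β : ℝ, 0 < β ∧ ∀ x ∈ X, ∀ t : ℝ, 0 ≤ t →
    ((Θ x t).conjTranspose * Θ x t - (β : ℂ) • (1 : Matrix (Fin n) (Fin n) ℂ)).PosSemidef

/-- The generalized Jacobian `F = Θ J Θ⁻¹ + Θ̇ Θ⁻¹`. -/
def generalizedJacobian {n : ℕ} (f : State n → ℝ → State n)
    (Θ : State n → ℝ → Matrix (Fin n) (Fin n) ℂ) (x : State n) (t : ℝ) :
    Matrix (Fin n) (Fin n) ℂ :=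
  Θ x t * jacobian f x t * (Θ x t)⁻¹
    + (Matrix.of fun a b => totalDeriv f (fun y s => Θ y s a b) x t) * (Θ x t)⁻¹

/-- The Hermitian part `(A + Aᴴ) / 2` of a complex square matrix. -/
def hermitianPart {n : ℕ} (A : Matrix (Fin n) (Fin n) ℂ) : Matrix (Fin n) (Fin n) ℂ :=
  (2⁻¹ : ℂ) • (A + A.conjTranspose)

theorem hermitianPart_isHermitian {n : ℕ} (A : Matrix (Fin n) (Fin n) ℂ) :
    (hermitianPart A).IsHermitian := by
  simp [hermitianPart, Matrix.IsHermitian, Matrix.conjTranspose_smul, add_comm]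

/-- The sum `λ₁ + ⋯ + λₖ` of the `k` largest eigenvalues (with multiplicity) of a Hermitian matrix;
`eigenvalues₀` lists the eigenvalues in non-increasing order. -/
def sumLargestEigenvalues {n : ℕ} {H : Matrix (Fin n) (Fin n) ℂ} (hH : H.IsHermitian) (k : ℕ) :
    ℝ :=
  ∑ j : Fin (Fintype.card (Fin n)) with j.val < k, hH.eigenvalues₀ j

/-- `x` is a solution of `ẋ = f(x, t)` on `[t₀, ∞)` that stays in `X`. -/
def IsTrajectory {n : ℕ} (X : Set (State n)) (f : State n → ℝ → State n) (t₀ : ℝ)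
    (x : ℝ → State n) : Prop :=
  ∀ t, t₀ ≤ t → x t ∈ X ∧ HasDerivWithinAt x (f (x t) t) (Ici t₀) t

/-- `δx` is a differential displacement along the trajectory `x` on `[t₀, ∞)`: a solution of the
variational equation `d(δx)/dt = (∂f/∂x)(x(t), t) δx`. -/
def IsDisplacement {n : ℕ} (f : State n → ℝ → State n) (t₀ : ℝ) (x δx : ℝ → State n) : Prop :=
  ∀ t, t₀ ≤ t → HasDerivWithinAt δx (fderiv ℝ (fun y => f y t) (x t) (δx t)) (Ici t₀) t

/-- The transformed displacement `δz = Θ δx`, for a matrix `Θ` and a vector `δx`. -/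
def transformed {n : ℕ} (Θ : Matrix (Fin n) (Fin n) ℂ) (v : State n) :
    EuclideanSpace ℂ (Fin n) :=
  WithLp.toLp 2 (Θ.mulVec fun a => ((v a : ℝ) : ℂ))

/-- The norm `‖v₁ ∧ ⋯ ∧ vᵢ‖`, i.e. the `i`-dimensional volume of the parallelotope spanned by
`v₁, …, vᵢ`: the square root of the Gram determinant (which is real and nonnegative). -/
def wedgeNorm {n i : ℕ} (v : Fin i → EuclideanSpace ℂ (Fin n)) : ℝ :=
  Real.sqrt (Matrix.gram ℂ v).det.re

end VolumeContraction

end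

open VolumeContraction

namespace VolumeContraction

open Matrix

/-! Let `M` have columns `δz_j` and let `G = Mᴴ M` be its Gram matrix, with determinant `D`, the
squared volume. The `δz_j` solve `v' = F v`, so Jacobi's formula gives `D' = 2 Re tr (H P)`, where
`H` is the Hermitian part of `F` and `P = M adj(G) Mᴴ`. Since `P² = D P` and `tr P = i D`, `P` is
`D` times a rank-`i` orthogonal projection when `D > 0`, and Ky Fan's inequality yields `D' ≤ 2 (λ₁
+ ⋯ + λᵢ) D`. Hence `D exp (2 (γ + α t))` is nonincreasing along trajectories, and boundedness of
`γ` turns this into the exponential bound. -/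

/-- **Jacobi's formula**: the derivative of a determinant is `tr (adj A * A')`. -/
theorem hasDerivWithinAt_det {m : Type*} [Fintype m] [DecidableEq m]
    {A : ℝ → Matrix m m ℂ} {A' : Matrix m m ℂ} {s : Set ℝ} {t : ℝ}
    (hA : ∀ a b, HasDerivWithinAt (fun τ => A τ a b) (A' a b) s t) :
    HasDerivWithinAt (fun τ => (A τ).det) (((A t).adjugate * A').trace) s t := by
  have key : ((A t).adjugate * A').trace = ∑ σ : Equiv.Perm m,
      ((Equiv.Perm.sign σ : ℤ) : ℂ) *
        ∑ k, (∏ j ∈ Finset.univ.erase k, A t (σ j) j) • A' (σ k) k := by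
    simp_rw [Finset.mul_sum]
    rw [Finset.sum_comm]
    refine Finset.sum_congr rfl fun k _ => ?_
    -- Cramer's rule: a diagonal entry is the determinant with column `k` differentiated.
    have h1 : ((A t).adjugate * A') k k = ((A t).updateCol k (fun a => A' a k)).det := by
      rw [← cramer_apply, cramer_eq_adjugate_mulVec]
      rfl
    rw [diag_apply, h1, det_apply']
    refine Finset.sum_congr rfl fun σ _ => ?_
    rw [← Finset.prod_erase_mul _ _ (Finset.mem_univ k), updateCol_self, smul_eq_mul]
    congr 2
    refine Finset.prod_congr rfl fun j hj => ?_
    rw [updateCol_ne (Finset.ne_of_mem_erase hj)]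
  rw [key]
  simp_rw [det_apply']
  refine HasDerivWithinAt.fun_sum fun σ _ => HasDerivWithinAt.const_mul _ ?_
  exact HasDerivWithinAt.fun_finsetProd fun j _ => hA (σ j) j

/-! ### Ky Fan's inequality -/

/-- A weighted sum with weights in `[0, d]` of total mass `k d` is at most `d` times the sum of the
`k` largest terms. -/
theorem sum_mul_le_mul_sum_largest {m k : ℕ} (hk : 1 ≤ k) (hkm : k ≤ m) {l q : Fin m → ℝ}
    (hl : Antitone l) {d : ℝ} (hq0 : ∀ j, 0 ≤ q j) (hqd : ∀ j, q j ≤ d)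
    (hq : ∑ j, q j = k * d) :
    ∑ j, l j * q j ≤ d * ∑ j with j.val < k, l j := by
  -- `c` is the `k`-th largest term. Subtracting it from every term shifts both sides by `k d c`,
  -- and the terms then change sign exactly at the cutoff.
  set c := l ⟨k - 1, by omega⟩
  have hcard : (Finset.univ.filter fun j : Fin m => j.val < k).card = k := by
    rw [Fin.card_filter_val_lt, min_eq_right hkm]
  have h1 : ∑ j, (l j - c) * q j ≤ ∑ j, if j.val < k then (l j - c) * d else 0 := by
    refine Finset.sum_le_sum fun j _ => ?_
    split_ifs with hj
    · have : c ≤ l j := hl (Fin.le_def.2 (by simp; omega))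
      exact mul_le_mul_of_nonneg_left (hqd j) (by linarith)
    · have : l j ≤ c := hl (Fin.le_def.2 (by simp; omega))
      exact mul_nonpos_of_nonpos_of_nonneg (by linarith) (hq0 j)
  rw [← Finset.sum_filter, ← Finset.sum_mul, Finset.sum_sub_distrib, Finset.sum_const, hcard,
    nsmul_eq_mul] at h1
  simp_rw [sub_mul] at h1
  rw [Finset.sum_sub_distrib, ← Finset.mul_sum, hq] at h1
  linarith

/-- Diagonal entries of a scaled orthogonal projection lie between zero and the scale. -/
theorem diag_mem_Icc_of_mul_self {m : Type*} [Fintype m] {Q : Matrix m m ℂ} (hQ : Q.IsHermitian)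
    {d : ℝ} (hd : 0 ≤ d) (hQQ : Q * Q = (d : ℂ) • Q) (a : m) :
    0 ≤ (Q a a).re ∧ (Q a a).re ≤ d := by
  -- The `(a, a)` entry of `Q Qᴴ = d Q`.
  have h1 : ∑ b, Complex.normSq (Q a b) = d * (Q a a).re := by
    have := congrArg Complex.re (congrFun (congrFun hQQ a) a)
    rw [mul_apply, Complex.re_sum, Matrix.smul_apply, smul_eq_mul, Complex.re_ofReal_mul] at this
    rw [← this]
    refine Finset.sum_congr rfl fun b _ => ?_
    rw [← hQ.apply b a, ← Complex.ofReal_re (Complex.normSq _), ← Complex.mul_conj]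
    rfl
  have h2 : (Q a a).re * (Q a a).re ≤ d * (Q a a).re := by
    rw [← h1]
    calc (Q a a).re * (Q a a).re ≤ Complex.normSq (Q a a) := by
          rw [Complex.normSq_apply]; nlinarith [mul_self_nonneg (Q a a).im]
      _ ≤ _ := Finset.single_le_sum (f := fun b => Complex.normSq (Q a b))
          (fun b _ => Complex.normSq_nonneg _) (Finset.mem_univ a)
  constructor <;> by_contra! hlt <;> nlinarith

/-- **Ky Fan's inequality**: the trace of a Hermitian matrix against a scaled orthogonal projection
of rank `k` is at most the scale times the sum of the `k` largest eigenvalues. -/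
theorem re_trace_mul_le_mul_sumLargestEigenvalues {n k : ℕ} (hk : 1 ≤ k) (hkn : k ≤ n)
    {H P : Matrix (Fin n) (Fin n) ℂ} (hH : H.IsHermitian) (hP : P.IsHermitian) {d : ℝ} (hd : 0 ≤ d)
    (hPP : P * P = (d : ℂ) • P) (htr : P.trace = k * d) :
    (H * P).trace.re ≤ d * sumLargestEigenvalues hH k := by
  set U : Matrix (Fin n) (Fin n) ℂ := (hH.eigenvectorUnitary : Matrix (Fin n) (Fin n) ℂ)
  have hUU : U * star U = 1 := Unitary.coe_mul_star_self _
  set Q := star U * P * U with hQdef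
  have hQ : Q.IsHermitian := by
    rw [IsHermitian, hQdef, star_eq_conjTranspose]
    simp [Matrix.mul_assoc, hP.eq]
  have hQQ : Q * Q = (d : ℂ) • Q := by
    calc Q * Q = star U * P * (U * star U) * P * U := by simp only [hQdef, Matrix.mul_assoc]
      _ = star U * (P * P) * U := by rw [hUU]; simp only [Matrix.mul_assoc, Matrix.one_mul]
      _ = _ := by rw [hPP, hQdef]; simp
  have hQtr : Q.trace = k * d := by
    rw [hQdef, trace_mul_comm, ← Matrix.mul_assoc, hUU, Matrix.one_mul, htr]
  have hHP : (H * P).trace.re = ∑ a, hH.eigenvalues a * (Q a a).re := by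
    have : H = U * Matrix.diagonal (RCLike.ofReal ∘ hH.eigenvalues) * star U := by
      conv_lhs => rw [hH.spectral_theorem, Unitary.conjStarAlgAut_apply]
    have h2 : (H * P).trace = (Matrix.diagonal (RCLike.ofReal ∘ hH.eigenvalues) * Q).trace := by
      conv_lhs => rw [this]
      rw [Matrix.mul_assoc, Matrix.mul_assoc, trace_mul_comm, hQdef]
      simp only [Matrix.mul_assoc]
    rw [h2, trace, Complex.re_sum]
    refine Finset.sum_congr rfl fun a _ => ?_
    rw [diag_apply, Matrix.diagonal_mul]
    exact Complex.re_ofReal_mul _ _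
  -- The equivalence through which `eigenvalues` is defined from the sorted `eigenvalues₀`.
  let e : Fin (Fintype.card (Fin n)) ≃ Fin n := Fintype.equivOfCardEq (Fintype.card_fin _)
  have hre : ∑ a, (Q a a).re = k * d := by
    have := congrArg Complex.re hQtr
    rw [trace, Complex.re_sum] at this
    simpa using this
  rw [hHP, ← e.sum_comp]
  have hev : ∀ j, hH.eigenvalues (e j) = hH.eigenvalues₀ j := fun j =>
    congrArg hH.eigenvalues₀ (e.symm_apply_apply j)
  simp_rw [hev]
  exact sum_mul_le_mul_sum_largest hk (by simpa using hkn) hH.eigenvalues₀_antitone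
    (fun j => (diag_mem_Icc_of_mul_self hQ hd hQQ _).1)
    (fun j => (diag_mem_Icc_of_mul_self hQ hd hQQ _).2) (by rw [e.sum_comp fun a => (Q a a).re, hre])

/-! ### Gram determinants and their growth rate -/

/-- The matrix with columns `v j`. -/
def columnMatrix {n i : ℕ} (v : Fin i → EuclideanSpace ℂ (Fin n)) : Matrix (Fin n) (Fin i) ℂ :=
  Matrix.of fun a j => v j a

theorem gram_eq_conjTranspose_mul {n i : ℕ} (v : Fin i → EuclideanSpace ℂ (Fin n)) :
    gram ℂ v = (columnMatrix v)ᴴ * columnMatrix v := by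
  ext j k
  rw [gram_apply, mul_apply, PiLp.inner_apply]
  refine Finset.sum_congr rfl fun a _ => ?_
  simp [columnMatrix, mul_comm]

/-- The determinant of a Gram matrix, as a real number. -/
noncomputable def gramDet {n i : ℕ} (v : Fin i → EuclideanSpace ℂ (Fin n)) : ℝ :=
  (gram ℂ v).det.re

open scoped ComplexOrder in
theorem gramDet_nonneg {n i : ℕ} (v : Fin i → EuclideanSpace ℂ (Fin n)) : 0 ≤ gramDet v :=
  (RCLike.nonneg_iff.1 (posSemidef_gram ℂ v).det_nonneg).1

open scoped ComplexOrder in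
theorem ofReal_gramDet {n i : ℕ} (v : Fin i → EuclideanSpace ℂ (Fin n)) :
    (gramDet v : ℂ) = (gram ℂ v).det :=
  Complex.ext rfl (RCLike.nonneg_iff.1 (posSemidef_gram ℂ v).det_nonneg).2.symm

/-- The logarithmic growth rate of a Gram determinant under a linear flow with generator `F` is
bounded by twice the sum of the largest eigenvalues of the Hermitian part of `F`. -/
theorem re_trace_adjugate_mul_le {n i : ℕ} (hi : 1 ≤ i) (hin : i ≤ n)
    (F : Matrix (Fin n) (Fin n) ℂ) (v : Fin i → EuclideanSpace ℂ (Fin n)) :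
    ((gram ℂ v).adjugate *
        ((F * columnMatrix v)ᴴ * columnMatrix v + (columnMatrix v)ᴴ * (F * columnMatrix v))).trace.re
      ≤ 2 * sumLargestEigenvalues (hermitianPart_isHermitian F) i * gramDet v := by
  set M := columnMatrix v
  set G := gram ℂ v with hG
  have hGM : G = Mᴴ * M := gram_eq_conjTranspose_mul v
  -- The adjugate replaces `D G⁻¹`, so linearly dependent vectors need no separate case.
  set P := M * G.adjugate * Mᴴ with hPdef
  have hP : P.IsHermitian := by
    have : G.adjugateᴴ = G.adjugate := by
      rw [adjugate_conjTranspose, (isHermitian_gram ℂ v).eq]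
    rw [IsHermitian, hPdef]
    simp [Matrix.mul_assoc, this]
  have hPP : P * P = (gramDet v : ℂ) • P := by
    calc P * P = M * (G.adjugate * (Mᴴ * M)) * G.adjugate * Mᴴ := by
          simp only [hPdef, Matrix.mul_assoc]
      _ = _ := by
          rw [← hGM, adjugate_mul, ofReal_gramDet]
          simp [hPdef, ← hG]
  have htr : P.trace = i * gramDet v := by
    rw [hPdef, trace_mul_comm, ← Matrix.mul_assoc, ← hGM, mul_adjugate, ofReal_gramDet, trace_smul,
      trace_one, Fintype.card_fin, smul_eq_mul, mul_comm]
  have hFan := re_trace_mul_le_mul_sumLargestEigenvalues hi hin (hermitianPart_isHermitian F) hP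
    (gramDet_nonneg v) hPP htr
  have heq : (G.adjugate * ((F * M)ᴴ * M + Mᴴ * (F * M))).trace
      = 2 * (hermitianPart F * P).trace := by
    have h1 : (F * M)ᴴ * M + Mᴴ * (F * M) = Mᴴ * ((F + Fᴴ) * M) := by
      rw [conjTranspose_mul, Matrix.add_mul, Matrix.mul_add, add_comm, Matrix.mul_assoc]
    rw [h1, hermitianPart, smul_mul, trace_smul, smul_eq_mul, mul_inv_cancel_left₀ two_ne_zero,
      hPdef, trace_mul_comm (F + Fᴴ), Matrix.mul_assoc M, Matrix.mul_assoc M, trace_mul_comm M]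
    simp only [Matrix.mul_assoc]
  rw [heq, show (2 : ℂ) = ((2 : ℝ) : ℂ) by norm_num, Complex.re_ofReal_mul]
  linarith

end VolumeContraction

namespace VolumeContraction

open Matrix

/-! ### Evolution along trajectories -/

theorem hasDerivWithinAt_along {n : ℕ} {G : Type*} [NormedAddCommGroup G] [NormedSpace ℝ G]
    {X : Set (State n)} {f : State n → ℝ → State n} {g : State n → ℝ → G}
    (hg : DifferentiableOnTube X g) {t₀ : ℝ} (ht₀ : 0 ≤ t₀) {x : ℝ → State n}
    (hx : IsTrajectory X f t₀ x) {t : ℝ} (ht : t₀ ≤ t) :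
    HasDerivWithinAt (fun τ => g (x τ) τ) (totalDeriv f g (x t) t) (Ici t₀) t :=
  HasFDerivWithinAt.comp_hasDerivWithinAt (f := fun τ => (x τ, τ)) t
    (hg (x t) (hx t ht).1 t (ht₀.trans ht)).hasFDerivWithinAt
    ((hx t ht).2.prodMk (hasDerivWithinAt_id t _))
    fun _ hτ => ⟨mem_univ _, ht₀.trans hτ⟩

/-- `Θᴴ Θ` is `β I` plus a positive semidefinite matrix, hence invertible. -/
theorem IsMetricTransformation.isUnit_det {n : ℕ} {X : Set (State n)}
    {Θ : State n → ℝ → Matrix (Fin n) (Fin n) ℂ} (hΘ : IsMetricTransformation X Θ) {x : State n}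
    (hx : x ∈ X) {t : ℝ} (ht : 0 ≤ t) : IsUnit (Θ x t).det := by
  open scoped ComplexOrder in
  obtain ⟨β, hβ, h⟩ := hΘ.uniformly_posDef
  have h1 : ((β : ℂ) • (1 : Matrix (Fin n) (Fin n) ℂ)).PosDef :=
    PosDef.one.smul (by exact_mod_cast hβ)
  have h2 := (PosDef.add_posSemidef h1 (h x hx t ht)).isUnit
  rw [add_sub_cancel, isUnit_iff_isUnit_det, det_mul] at h2
  exact isUnit_of_mul_isUnit_right h2

theorem jacobian_mulVec {n : ℕ} (f : State n → ℝ → State n) (x : State n) (t : ℝ) (v : State n)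
    (a : Fin n) :
    ((fderiv ℝ (fun y => f y t) x v a : ℝ) : ℂ) =
      (jacobian f x t *ᵥ fun b => ((v b : ℝ) : ℂ)) a := by
  have hv : v = ∑ b, v b • EuclideanSpace.single b (1 : ℝ) := by
    simpa using ((EuclideanSpace.basisFun (Fin n) ℝ).sum_repr v).symm
  conv_lhs => rw [hv]
  simp [mulVec, dotProduct, jacobian, mul_comm]

/-- Transformed displacements solve `d(δz)/dt = F δz` with the generalized Jacobian `F`. -/
theorem hasDerivWithinAt_transformed {n : ℕ} {X : Set (State n)} {f : State n → ℝ → State n}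
    {Θ : State n → ℝ → Matrix (Fin n) (Fin n) ℂ} (hΘ : IsMetricTransformation X Θ)
    {t₀ : ℝ} (ht₀ : 0 ≤ t₀) {x δx : ℝ → State n} (hx : IsTrajectory X f t₀ x)
    (hδ : IsDisplacement f t₀ x δx) {t : ℝ} (ht : t₀ ≤ t) (a : Fin n) :
    HasDerivWithinAt (fun τ => transformed (Θ (x τ) τ) (δx τ) a)
      ((generalizedJacobian f Θ (x t) t *ᵥ (transformed (Θ (x t) t) (δx t)).ofLp) a)
      (Ici t₀) t := by
  set T := Θ (x t) t
  set w : Fin n → ℂ := fun b => ((δx t b : ℝ) : ℂ) with hw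
  set T' : Matrix (Fin n) (Fin n) ℂ :=
    Matrix.of fun a b => totalDeriv f (fun y s => Θ y s a b) (x t) t with hT'
  have hdet : IsUnit T.det := hΘ.isUnit_det (hx t ht).1 (ht₀.trans ht)
  have hF : generalizedJacobian f Θ (x t) t *ᵥ (transformed T (δx t)).ofLp
      = T' *ᵥ w + T *ᵥ (jacobian f (x t) t *ᵥ w) := by
    change (T * jacobian f (x t) t * T⁻¹ + T' * T⁻¹) *ᵥ (T *ᵥ w) = _
    rw [mulVec_mulVec, Matrix.add_mul, nonsing_inv_mul_cancel_right _ _ hdet,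
      nonsing_inv_mul_cancel_right _ _ hdet, add_mulVec, ← mulVec_mulVec, add_comm]
  have hv (b : Fin n) : HasDerivWithinAt (fun τ => ((δx τ b : ℝ) : ℂ))
      ((jacobian f (x t) t *ᵥ w) b) (Ici t₀) t := by
    rw [hw, ← jacobian_mulVec]
    have h1 : HasDerivWithinAt (fun τ => δx τ b)
        (fderiv ℝ (fun y => f y t) (x t) (δx t) b) (Ici t₀) t :=
      (EuclideanSpace.proj (𝕜 := ℝ) b).hasFDerivAt.comp_hasDerivWithinAt t (hδ t ht)
    exact h1.ofReal_comp
  rw [hF, Pi.add_apply, mulVec, mulVec, dotProduct, dotProduct, ← Finset.sum_add_distrib]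
  change HasDerivWithinAt (fun τ => ∑ b, Θ (x τ) τ a b * ((δx τ b : ℝ) : ℂ)) _ _ _
  refine HasDerivWithinAt.fun_sum fun b _ => ?_
  exact (hasDerivWithinAt_along (hΘ.differentiable a b) ht₀ hx ht).mul (hv b)

/-- The derivative of a Gram determinant of solutions of `v' = F v`. -/
theorem hasDerivWithinAt_gramDet {n i : ℕ} {F : Matrix (Fin n) (Fin n) ℂ}
    {v : ℝ → Fin i → EuclideanSpace ℂ (Fin n)} {s : Set ℝ} {t : ℝ}
    (hv : ∀ j a, HasDerivWithinAt (fun τ => v τ j a) ((F *ᵥ (v t j).ofLp) a) s t) :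
    HasDerivWithinAt (fun τ => gramDet (v τ))
      ((gram ℂ (v t)).adjugate *
        ((F * columnMatrix (v t))ᴴ * columnMatrix (v t)
          + (columnMatrix (v t))ᴴ * (F * columnMatrix (v t)))).trace.re s t := by
  have hG : HasDerivWithinAt (fun τ => (gram ℂ (v τ)).det) _ s t :=
    hasDerivWithinAt_det (A' := (F * columnMatrix (v t))ᴴ * columnMatrix (v t)
          + (columnMatrix (v t))ᴴ * (F * columnMatrix (v t))) fun j k => by
      simp_rw [gram_eq_conjTranspose_mul, Matrix.add_apply, mul_apply (M := _ᴴ), conjTranspose_apply,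
        ← Finset.sum_add_distrib]
      exact HasDerivWithinAt.fun_sum fun a _ => (hv j a).star.mul (hv k a)
  exact (Complex.reCLM.hasFDerivAt (x := (gram ℂ (v t)).det)).comp_hasDerivWithinAt t hG

/-- If `D' ≤ 2 S D` with `S + g' ≤ -α`, then `D` decays like `exp (-2 α t)` up to the factor
`exp (-2 g)`. -/
theorem le_exp_mul_of_deriv_le {D g D' g' S : ℝ → ℝ} {t₀ α : ℝ}
    (hD : ∀ t, t₀ ≤ t → HasDerivWithinAt D (D' t) (Ici t₀) t)
    (hg : ∀ t, t₀ ≤ t → HasDerivWithinAt g (g' t) (Ici t₀) t)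
    (hD0 : ∀ t, 0 ≤ D t) (hle : ∀ t, t₀ ≤ t → D' t ≤ 2 * S t * D t)
    (hS : ∀ t, t₀ ≤ t → S t + g' t ≤ -α) {t : ℝ} (ht : t₀ ≤ t) :
    D t ≤ Real.exp (2 * (g t₀ - g t - α * (t - t₀))) * D t₀ := by
  have hder (τ : ℝ) (hτ : t₀ ≤ τ) :
      HasDerivWithinAt (fun τ => D τ * Real.exp (2 * (g τ + α * τ)))
        (D' τ * Real.exp (2 * (g τ + α * τ))
          + D τ * (Real.exp (2 * (g τ + α * τ)) * (2 * (g' τ + α * 1)))) (Ici t₀) τ :=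
    (hD τ hτ).mul ((((hg τ hτ).add ((hasDerivWithinAt_id τ _).const_mul α)).const_mul 2).exp)
  -- Integrating factor: up to a positive exponential, the derivative is at most `2 D (S + g' + α) ≤
  -- 0`.
  have hanti : AntitoneOn (fun τ => D τ * Real.exp (2 * (g τ + α * τ))) (Ici t₀) := by
    refine antitoneOn_of_hasDerivWithinAt_nonpos (convex_Ici t₀)
      (fun τ hτ => (hder τ hτ).continuousWithinAt)
      (fun τ hτ => (hder τ (interior_subset hτ)).mono interior_subset) fun τ hτ => ?_
    have hτ' : t₀ ≤ τ := interior_subset hτ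
    have h1 : D' τ + D τ * (2 * (g' τ + α * 1)) ≤ 0 := by
      nlinarith [hle τ hτ', mul_nonneg (hD0 τ) (show 0 ≤ -α - (S τ + g' τ) by linarith [hS τ hτ'])]
    calc _ = (D' τ + D τ * (2 * (g' τ + α * 1))) * Real.exp (2 * (g τ + α * τ)) := by ring
      _ ≤ 0 := mul_nonpos_of_nonpos_of_nonneg h1 (Real.exp_pos _).le
  have h2 := hanti (mem_Ici.2 le_rfl) (mem_Ici.2 ht) ht
  have h3 : Real.exp (2 * (g t₀ - g t - α * (t - t₀)))
      = Real.exp (2 * (g t₀ + α * t₀)) / Real.exp (2 * (g t + α * t)) := by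
    rw [← Real.exp_sub]; ring_nf
  rw [h3, div_mul_eq_mul_div, le_div_iff₀ (Real.exp_pos _)]
  simpa [mul_comm] using h2

end VolumeContraction

open VolumeContraction
theorem theorem4 {n i : ℕ} (hi : 1 ≤ i) (hin : i ≤ n)
    (X : Set (State n)) (f : State n → ℝ → State n)
    (hf : ∀ x ∈ X, ∀ t : ℝ, 0 ≤ t → DifferentiableAt ℝ (fun y => f y t) x)
    (Θ : State n → ℝ → Matrix (Fin n) (Fin n) ℂ) (hΘ : IsMetricTransformation X Θ)
    (γ : State n → ℝ → ℝ) (hγ : DifferentiableOnTube X γ)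
    (hγb : ∃ B : ℝ, ∀ x ∈ X, ∀ t : ℝ, 0 ≤ t → |γ x t| ≤ B)
    (α : ℝ) (hα : 0 < α)
    (h : ∀ x ∈ X, ∀ t : ℝ, 0 ≤ t →
      sumLargestEigenvalues (hermitianPart_isHermitian (generalizedJacobian f Θ x t)) i
        + totalDeriv f γ x t ≤ -α) :
    ∃ C : ℝ, 0 < C ∧
      ∀ (t₀ : ℝ), 0 ≤ t₀ → ∀ x : ℝ → State n, IsTrajectory X f t₀ x →
        ∀ δx : Fin i → ℝ → State n, (∀ j, IsDisplacement f t₀ x (δx j)) →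
          (∀ t, t₀ ≤ t →
            wedgeNorm (fun j => transformed (Θ (x t) t) (δx j t)) ≤
              C * Real.exp (-α * (t - t₀)) *
                wedgeNorm (fun j => transformed (Θ (x t₀) t₀) (δx j t₀))) ∧
          Tendsto (fun t => wedgeNorm (fun j => transformed (Θ (x t) t) (δx j t)))
            atTop (𝓝 0) := by
  obtain ⟨B, hB⟩ := hγb
  -- `γ` varies by at most `2 B`; the factor 2 in the exponent for `D` is removed by the square
  -- root.
  refine ⟨Real.exp (2 * B), Real.exp_pos _, fun t₀ ht₀ x hx δx hδ => ?_⟩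
  set v : ℝ → Fin i → EuclideanSpace ℂ (Fin n) :=
    fun t j => transformed (Θ (x t) t) (δx j t) with hv
  have hbound : ∀ t, t₀ ≤ t →
      wedgeNorm (v t) ≤ Real.exp (2 * B) * Real.exp (-α * (t - t₀)) * wedgeNorm (v t₀) := by
    intro t ht
    have h1 : gramDet (v t) ≤
        Real.exp (2 * (γ (x t₀) t₀ - γ (x t) t - α * (t - t₀))) * gramDet (v t₀) :=
      le_exp_mul_of_deriv_le (D := fun t => gramDet (v t)) (g := fun t => γ (x t) t)
        (fun t ht => hasDerivWithinAt_gramDet (v := v)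
          fun j a => hasDerivWithinAt_transformed hΘ ht₀ hx (hδ j) ht a)
        (fun t ht => hasDerivWithinAt_along hγ ht₀ hx ht)
        (fun t => gramDet_nonneg _)
        (fun t _ => re_trace_adjugate_mul_le hi hin _ (v t))
        (fun t ht => h (x t) (hx t ht).1 t (ht₀.trans ht)) ht
    have hγ₀ := abs_le.1 (hB (x t₀) (hx t₀ le_rfl).1 t₀ ht₀)
    have hγt := abs_le.1 (hB (x t) (hx t ht).1 t (ht₀.trans ht))
    have h2 : gramDet (v t) ≤ Real.exp (2 * B + -α * (t - t₀)) ^ 2 * gramDet (v t₀) := by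
      refine h1.trans (mul_le_mul_of_nonneg_right ?_ (gramDet_nonneg _))
      rw [← Real.exp_nat_mul, Real.exp_le_exp]
      push_cast
      linarith
    calc wedgeNorm (v t) ≤ √(Real.exp (2 * B + -α * (t - t₀)) ^ 2 * gramDet (v t₀)) :=
          Real.sqrt_le_sqrt h2
      _ = _ := by
          rw [Real.sqrt_mul (sq_nonneg _), Real.sqrt_sq (Real.exp_pos _).le, Real.exp_add]
          rfl
  refine ⟨hbound, ?_⟩
  have hlim : Tendsto (fun t => Real.exp (2 * B) * Real.exp (-α * (t - t₀)) * wedgeNorm (v t₀))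
      atTop (𝓝 0) := by
    have h1 : Tendsto (fun t => -α * (t - t₀)) atTop atBot :=
      (tendsto_atTop_add_const_right atTop (-t₀) tendsto_id).const_mul_atTop_of_neg (neg_lt_zero.2 hα)
    simpa using ((Real.tendsto_exp_atBot.comp h1).const_mul (Real.exp (2 * B))).mul_const
      (wedgeNorm (v t₀))
  exact squeeze_zero' (Eventually.of_forall fun _ => Real.sqrt_nonneg _)
    ((eventually_ge_atTop t₀).mono hbound) hlim
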